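/- Work over $\mathbb{C}$. Let $n\ge 0$ and $d\ge 1$ be integers and let $S^d=H^0(\mathbf{P}^n,\mathcal{O}_{\mathbf{P}^n}(d))$, the space of homogeneous polynomials of degree $d$ in $n+1$ variables. (i) Let $M^d_{\mathbf{P}^n}$ be the kernel of the evaluation map $S^d\otimes\mathcal{O}_{\mathbf{P}^n}\to\mathcal{O}_{\mathbf{P}^n}(d)$. Then $M^d_{\mathbf{P}^n}\otimes\mathcal{O}_{\mathbf{P}^n}(1)$ is generated by its global sections. (ii) Let $G$ be the Grassmannian of lines in $\mathbf{P}^n$, i.e. of two-dimensional linear subspaces of $\mathbb{C}^{n+1}$, let $\mathcal{O}_G(1)$ be the line bundle giving its Plücker polarization, and let $\mathcal{E}_d=\mathrm{Sym}^d(\mathcal{S}^\vee)$ be the $d$-th symmetric power of the dual of the tautological rank two subbundle $\mathcal{S}\subset\mathbb{C}^{n+1}\otimes\mathcal{O}_G$, whose fibre at $[\ell]$ is $H^0(\ell,\mathcal{O}_\ell(d))$. Let $M^d_G$ be the kernel of the evaluation map $S^d\otimes\mathcal{O}_G\to\mathcal{E}_d$, which at $[\ell]$ is the restriction of polynomials to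 $\ell$. Then $M^d_G\otimes\mathcal{O}_G(1)$ is generated by its global sections. Here a vector bundle $E$ on a variety $X$ is generated by its global sections if $H^0(X,E)\otimes\mathcal{O}_X\to E$ is a surjection of sheaves, equivalently, if at every point the values of the global sections exhaust the fibre of $E$. -/

import Mathlib

open scoped LinearAlgebra.Projectivization TensorProduct Topology

noncomputable section

/-- The Zariski topology on the projective space of `σ → ℂ`: the sets `F ≠ 0`, `F` a homogeneous
polynomial, form a basis of open sets. -/
abbrev zariskiProj (σ : Type) : TopologicalSpace (ℙ ℂ (σ → ℂ)) :=
  TopologicalSpace.generateFrom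
    {U | ∃ (e : ℕ) (F : MvPolynomial σ ℂ), F.IsHomogeneous e ∧
      U = {p | MvPolynomial.eval p.rep F ≠ 0}}

/-- A complex variety in the classical sense, given with a projective embedding: its closed points
and the injective map `emb` to a projective space with homogeneous coordinates indexed by `Coord`.
It carries the Zariski topology and the regular functions induced by the embedding. -/
structure EmbeddedVariety where
  Pt : Type
  Coord : Type
  emb : Pt → ℙ ℂ (Coord → ℂ)
  emb_injective : Function.Injective emb

namespace EmbeddedVariety

/-- The Zariski topology, induced from the ambient projective space. -/
instance (X : EmbeddedVariety) : TopologicalSpace X.Pt :=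
  TopologicalSpace.induced X.emb (zariskiProj X.Coord)

variable (X : EmbeddedVariety)

/-- The value at `x` of `F`, for a fixed choice of homogeneous coordinates of `x`. Only the vanishing
of this value, and quotients of two such values for forms of equal degree, are used below; for
homogeneous `F` they do not depend on the choice. -/
def value (F : MvPolynomial X.Coord ℂ) (x : X.Pt) : ℂ :=
  MvPolynomial.eval (X.emb x).rep F

/-- `f` is regular in a neighbourhood of `x`: near `x` it is a quotient of two homogeneous
polynomials of the same degree in the homogeneous coordinates, with denominator nonzero at `x`.
(Values of `f` away from `x` play no role. The regular functions on an open `U` are the `f` that are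
regular at all points of `U`.) -/
def RegularAt (f : X.Pt → ℂ) (x : X.Pt) : Prop :=
  ∃ (e : ℕ) (P Q : MvPolynomial X.Coord ℂ), P.IsHomogeneous e ∧ Q.IsHomogeneous e ∧
    X.value Q x ≠ 0 ∧ ∀ᶠ y in 𝓝 x, f y = X.value P y / X.value Q y

variable {X}

theorem eventually_value_ne_zero {e : ℕ} {Q : MvPolynomial X.Coord ℂ} (hQ : Q.IsHomogeneous e)
    {x : X.Pt} (hx : X.value Q x ≠ 0) : ∀ᶠ y in 𝓝 x, X.value Q y ≠ 0 := by
  have h : IsOpen {y : X.Pt | X.value Q y ≠ 0} := by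
    refine ⟨{p | MvPolynomial.eval p.rep Q ≠ 0}, ?_, rfl⟩
    exact TopologicalSpace.isOpen_generateFrom_of_mem ⟨e, Q, hQ, rfl⟩
  exact h.mem_nhds hx

theorem RegularAt.eventually {f : X.Pt → ℂ} {x : X.Pt} (hf : X.RegularAt f x) :
    ∀ᶠ y in 𝓝 x, X.RegularAt f y := by
  obtain ⟨e, P, Q, hP, hQ, hx, h⟩ := hf
  filter_upwards [eventually_value_ne_zero hQ hx, h.eventually_nhds] with y h1 h2
  exact ⟨e, P, Q, hP, hQ, h1, h2⟩

theorem RegularAt.congr {f g : X.Pt → ℂ} {x : X.Pt} (hf : X.RegularAt f x)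
    (h : ∀ᶠ y in 𝓝 x, g y = f y) : X.RegularAt g x := by
  obtain ⟨e, P, Q, hP, hQ, hx, h'⟩ := hf
  refine ⟨e, P, Q, hP, hQ, hx, ?_⟩
  filter_upwards [h, h'] with y h1 h2
  rw [h1, h2]

theorem regularAt_const (c : ℂ) (x : X.Pt) : X.RegularAt (fun _ => c) x := by
  refine ⟨0, MvPolynomial.C c, MvPolynomial.C 1, MvPolynomial.isHomogeneous_C _ _,
    MvPolynomial.isHomogeneous_C _ _, ?_, ?_⟩
  · simp [value]
  · simp [value]

theorem RegularAt.add {f g : X.Pt → ℂ} {x : X.Pt} (hf : X.RegularAt f x)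
    (hg : X.RegularAt g x) : X.RegularAt (fun y => f y + g y) x := by
  obtain ⟨e, P, Q, hP, hQ, hx, h⟩ := hf
  obtain ⟨e', P', Q', hP', hQ', hx', h'⟩ := hg
  refine ⟨e + e', P * Q' + Q * P', Q * Q', (hP.mul hQ').add (hQ.mul hP'), hQ.mul hQ', ?_, ?_⟩
  · simpa [value] using And.intro hx hx'
  · filter_upwards [h, h', eventually_value_ne_zero hQ hx, eventually_value_ne_zero hQ' hx']
      with y h1 h2 h3 h4
    simp only [value, map_add, map_mul] at *
    rw [h1, h2, div_add_div _ _ h3 h4]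

theorem RegularAt.mul {f g : X.Pt → ℂ} {x : X.Pt} (hf : X.RegularAt f x)
    (hg : X.RegularAt g x) : X.RegularAt (fun y => f y * g y) x := by
  obtain ⟨e, P, Q, hP, hQ, hx, h⟩ := hf
  obtain ⟨e', P', Q', hP', hQ', hx', h'⟩ := hg
  refine ⟨e + e', P * P', Q * Q', hP.mul hP', hQ.mul hQ', ?_, ?_⟩
  · simpa [value] using And.intro hx hx'
  · filter_upwards [h, h'] with y h1 h2
    simp only [value, map_mul] at *
    rw [h1, h2, div_mul_div_comm]

theorem RegularAt.sum {k : ℕ} {f : Fin k → X.Pt → ℂ} {x : X.Pt}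
    (hf : ∀ i, X.RegularAt (f i) x) : X.RegularAt (fun y => ∑ i, f i y) x := by
  induction k with
  | zero => simpa using regularAt_const 0 x
  | succ k ih =>
    simp only [Fin.sum_univ_succ]
    exact (hf 0).add (ih fun i => hf i.succ)

end EmbeddedVariety

open EmbeddedVariety

/-- A family of complex vector spaces `Fiber x` over the points of `X`, with a sheaf of
`𝒪_X`-modules of sections. `RegularAt s x` says that `s` is a regular section on some neighbourhood
of `x`; the module of regular sections on an open `U` consists of the families `s` on `U` that are
regular at all points of `U`. An algebraic vector bundle is considered through its fibres and the
regular sections. -/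
structure AlgBundle (X : EmbeddedVariety) where
  Fiber : X.Pt → Type
  [addCommGroup : ∀ x, AddCommGroup (Fiber x)]
  [module : ∀ x, Module ℂ (Fiber x)]
  RegularAt : (∀ x, Fiber x) → X.Pt → Prop
  eventually : ∀ {s x}, RegularAt s x → ∀ᶠ y in 𝓝 x, RegularAt s y
  congr : ∀ {s t x}, RegularAt s x → (∀ᶠ y in 𝓝 x, t y = s y) → RegularAt t x
  zero : ∀ x, RegularAt (fun _ => 0) x
  add : ∀ {s t x}, RegularAt s x → RegularAt t x → RegularAt (fun y => s y + t y) x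
  smul : ∀ {f : X.Pt → ℂ} {s x}, X.RegularAt f x → RegularAt s x →
    RegularAt (fun y => f y • s y) x

namespace AlgBundle

attribute [instance] AlgBundle.addCommGroup AlgBundle.module

variable {X : EmbeddedVariety}

/-- `s` is a global (regular) section. -/
def IsGlobalSection (E : AlgBundle X) (s : ∀ x, E.Fiber x) : Prop :=
  ∀ x, E.RegularAt s x

/-- `E` is generated by its global sections: at every point `x`, each germ of a regular section is a
finite combination of global sections with coefficients regular functions near `x` (that is,
`H⁰(X, E) ⊗ 𝒪_X → E` is a surjection of sheaves), and the values at `x` of the global sections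
exhaust the fibre. For vector bundles the two conditions are equivalent. -/
def GloballyGenerated (E : AlgBundle X) : Prop :=
  (∀ (x : X.Pt) (s : ∀ y, E.Fiber y), E.RegularAt s x →
    ∃ (k : ℕ) (f : Fin k → X.Pt → ℂ) (t : Fin k → ∀ y, E.Fiber y),
      (∀ i, X.RegularAt (f i) x) ∧ (∀ i, E.IsGlobalSection (t i)) ∧
        ∀ᶠ y in 𝓝 x, s y = ∑ i, f i y • t i y) ∧
  (∀ (x : X.Pt) (v : E.Fiber x), ∃ s, E.IsGlobalSection s ∧ s x = v)

theorem sum (E : AlgBundle X) {k : ℕ} {s : Fin k → ∀ y, E.Fiber y} {x : X.Pt}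
    (hs : ∀ i, E.RegularAt (s i) x) : E.RegularAt (fun y => ∑ i, s i y) x := by
  induction k with
  | zero => simpa using E.zero x
  | succ k ih =>
    simp only [Fin.sum_univ_succ]
    exact E.add (hs 0) (ih fun i => hs i.succ)

/-- The family `Fib` with the sheaf of sections generated, locally and over the regular functions, by
the sections that satisfy `Gen`. -/
abbrev generated (Fib : X.Pt → Type) [∀ x, AddCommGroup (Fib x)] [∀ x, Module ℂ (Fib x)]
    (Gen : (∀ x, Fib x) → X.Pt → Prop)
    (hGen : ∀ g x, Gen g x → ∀ᶠ y in 𝓝 x, Gen g y) : AlgBundle X where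
  Fiber := Fib
  RegularAt s x := ∃ (k : ℕ) (f : Fin k → X.Pt → ℂ) (g : Fin k → ∀ y, Fib y),
    (∀ i, X.RegularAt (f i) x) ∧ (∀ i, Gen (g i) x) ∧ ∀ᶠ y in 𝓝 x, s y = ∑ i, f i y • g i y
  eventually := by
    rintro s x ⟨k, f, g, hf, hg, h⟩
    have hf' := Filter.eventually_all.2 fun i => (hf i).eventually
    have hg' := Filter.eventually_all.2 fun i => hGen _ _ (hg i)
    filter_upwards [hf', hg', h.eventually_nhds] with y h1 h2 h3
    exact ⟨k, f, g, h1, h2, h3⟩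
  congr := by
    rintro s t x ⟨k, f, g, hf, hg, h⟩ hst
    refine ⟨k, f, g, hf, hg, ?_⟩
    filter_upwards [h, hst] with y h1 h2
    rw [h2, h1]
  zero x := ⟨0, Fin.elim0, Fin.elim0, fun i => i.elim0, fun i => i.elim0, by simp⟩
  add := by
    rintro s t x ⟨k, f, g, hf, hg, h⟩ ⟨k', f', g', hf', hg', h'⟩
    refine ⟨k + k', Fin.append f f', Fin.append g g', ?_, ?_, ?_⟩
    · intro i
      induction i using Fin.addCases with
      | left i => simpa using hf i
      | right i => simpa using hf' i
    · intro i
      induction i using Fin.addCases with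
      | left i => simpa using hg i
      | right i => simpa using hg' i
    · filter_upwards [h, h'] with y h1 h2
      rw [h1, h2, Fin.sum_univ_add]
      simp
  smul := by
    rintro a s x ha ⟨k, f, g, hf, hg, h⟩
    refine ⟨k, fun i y => a y * f i y, g, fun i => ha.mul (hf i), hg, ?_⟩
    filter_upwards [h] with y h1
    rw [h1, Finset.smul_sum]
    simp [mul_smul]

/-- The trivial bundle `A ⊗ 𝒪_X`. -/
abbrev trivial (X : EmbeddedVariety) (A : Type) [AddCommGroup A] [Module ℂ A] : AlgBundle X :=
  generated (fun _ => A) (fun g _ => ∃ a : A, ∀ y, g y = a) fun _ _ h => .of_forall fun _ => h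

/-- The subfamily `T x ⊆ A` of the trivial bundle `A ⊗ 𝒪_X`: a section is regular if it is regular
as a section of `A ⊗ 𝒪_X`. -/
abbrev sub {A : Type} [AddCommGroup A] [Module ℂ A] (T : X.Pt → Submodule ℂ A) : AlgBundle X where
  Fiber x := T x
  RegularAt s x := (trivial X A).RegularAt (fun y => (s y : A)) x
  eventually h := (trivial X A).eventually h
  congr h h' := (trivial X A).congr h (h'.mono fun y hy => by rw [hy])
  zero x := (trivial X A).zero x
  add h h' := (trivial X A).add h h'
  smul hf h := (trivial X A).smul hf h

/-- The dual bundle `E^∨ = Hom(E, 𝒪_X)`: a family of linear forms on the fibres is regular if it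
sends all local regular sections of `E` to regular functions. -/
abbrev dual (E : AlgBundle X) : AlgBundle X where
  Fiber x := Module.Dual ℂ (E.Fiber x)
  RegularAt φ x := ∀ᶠ y in 𝓝 x, ∀ s, E.RegularAt s y → X.RegularAt (fun z => φ z (s z)) y
  eventually h := h.eventually_nhds
  congr h h' := by
    filter_upwards [h, h'.eventually_nhds] with y h1 h2 s hs
    exact (h1 s hs).congr (h2.mono fun z hz => by rw [hz])
  zero x := .of_forall fun y s _ => by simpa using regularAt_const 0 y
  add h h' := by
    filter_upwards [h, h'] with y h1 h2 s hs
    exact (h1 s hs).add (h2 s hs)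
  smul hf h := by
    filter_upwards [h, hf.eventually] with y h1 h2 s hs
    exact h2.mul (h1 s hs)

/-- The tensor product `E ⊗ F`: the fibres are the tensor products of the fibres, and the regular
sections are locally the finite sums of tensor products of regular sections. -/
abbrev tensor (E F : AlgBundle X) : AlgBundle X :=
  generated (fun x => E.Fiber x ⊗[ℂ] F.Fiber x)
    (fun g x => ∃ s t, E.RegularAt s x ∧ F.RegularAt t x ∧ ∀ y, g y = s y ⊗ₜ[ℂ] t y)
    (by
      rintro g x ⟨s, t, hs, ht, h⟩
      filter_upwards [E.eventually hs, F.eventually ht] with y h1 h2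
      exact ⟨s, t, h1, h2, h⟩)

/-- `Sym^d (V^∨)` as the space of homogeneous polynomial functions of degree `d` on `V`: the span of
the products of `d` linear forms. -/
def symPowDual (V : Type) [AddCommGroup V] [Module ℂ V] (d : ℕ) : Submodule ℂ (V → ℂ) :=
  Submodule.span ℂ {f | ∃ φ : Fin d → Module.Dual ℂ V, f = fun v => ∏ i, φ i v}

/-- The bundle `Sym^d (E^∨)`: its regular sections are locally the combinations, with coefficients
regular functions, of products of `d` regular sections of `E^∨`. -/
abbrev symDual (E : AlgBundle X) (d : ℕ) : AlgBundle X :=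
  generated (fun x => symPowDual (E.Fiber x) d)
    (fun g x => ∃ φ : Fin d → ∀ y, Module.Dual ℂ (E.Fiber y),
      (∀ i, E.dual.RegularAt (φ i) x) ∧ ∀ y, (g y).1 = fun v => ∏ i, φ i y v)
    (by
      rintro g x ⟨φ, hφ, h⟩
      filter_upwards [Filter.eventually_all.2 fun i => E.dual.eventually (hφ i)] with y h1
      exact ⟨φ, h1, h⟩)

/-- A morphism of bundles: linear on the fibres, sending regular sections to regular sections. -/
structure Hom (E F : AlgBundle X) where
  map : ∀ x, E.Fiber x →ₗ[ℂ] F.Fiber x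
  regular : ∀ s x, E.RegularAt s x → F.RegularAt (fun y => map y (s y)) x

/-- The kernel of a morphism: the fibre at `x` is the kernel on the fibres at `x`, and the regular
sections are those of `E` that are mapped to zero. -/
abbrev ker {E F : AlgBundle X} (φ : Hom E F) : AlgBundle X where
  Fiber x := LinearMap.ker (φ.map x)
  RegularAt s x := E.RegularAt (fun y => (s y : E.Fiber y)) x
  eventually h := E.eventually h
  congr h h' := E.congr h (h'.mono fun y hy => by rw [hy])
  zero x := E.zero x
  add h h' := E.add h h'
  smul hf h := E.smul hf h

theorem eval_monomial_eq_prod {J : Type} {d : ℕ} (m : J →₀ ℕ) (hm : m.degree = d) (c : ℂ) :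
    ∃ l : Fin d → J, ∀ v : J → ℂ,
      MvPolynomial.eval v (MvPolynomial.monomial m c) = c * ∏ i, v (l i) := by
  classical
  have hc : (Finsupp.toMultiset m).toList.length = d := by
    rw [Multiset.length_toList, Finsupp.card_toMultiset, ← hm]; rfl
  subst hc
  refine ⟨fun i => (Finsupp.toMultiset m).toList.get i, fun v => ?_⟩
  rw [MvPolynomial.eval_monomial]
  congr 1
  have h1 : ((Finsupp.toMultiset m).map v).prod = m.prod fun n e => v n ^ e := by
    rw [Finsupp.toMultiset_map, Finsupp.prod_toMultiset,
      Finsupp.prod_mapDomain_index (by simp) (by intros; rw [pow_add])]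
  rw [← h1, ← List.prod_ofFn]
  conv_lhs => rw [← Multiset.coe_toList (Finsupp.toMultiset m)]
  rw [Multiset.map_coe, Multiset.prod_coe]
  congr 1
  apply List.ext_get <;> simp

variable {J : Type}

theorem eval_mem_symPowDual (W : Submodule ℂ (J → ℂ)) {d : ℕ} {F : MvPolynomial J ℂ}
    (hF : F.IsHomogeneous d) :
    (fun v : W => MvPolynomial.eval (v : J → ℂ) F) ∈ symPowDual W d := by
  have key : (fun v : W => MvPolynomial.eval (v : J → ℂ) F) =
      ∑ m ∈ F.support, fun v : W =>
        MvPolynomial.eval (v : J → ℂ) (MvPolynomial.monomial m (F.coeff m)) := by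
    funext v
    conv_lhs => rw [← MvPolynomial.support_sum_monomial_coeff F]
    simp only [map_sum, Finset.sum_apply]
  rw [key]
  refine Submodule.sum_mem _ fun m hm => ?_
  obtain ⟨l, hl⟩ := eval_monomial_eq_prod (d := d) m
    (by rw [Finsupp.degree_eq_weight_one]; exact hF (MvPolynomial.mem_support_iff.1 hm))
    (F.coeff m)
  have : (fun v : W => MvPolynomial.eval (v : J → ℂ) (MvPolynomial.monomial m (F.coeff m))) =
      F.coeff m • fun v : W =>
        ∏ i, ((LinearMap.proj (l i) : (J → ℂ) →ₗ[ℂ] ℂ) ∘ₗ W.subtype) v := by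
    funext v
    simp [hl]
  rw [this]
  exact Submodule.smul_mem _ _ (Submodule.subset_span
    ⟨fun i => (LinearMap.proj (l i) : (J → ℂ) →ₗ[ℂ] ℂ) ∘ₗ W.subtype, rfl⟩)

/-- Restriction to a linear subspace `W ⊆ ℂ^J` of homogeneous polynomials of degree `d`. -/
def restrict (W : Submodule ℂ (J → ℂ)) (d : ℕ) :
    MvPolynomial.homogeneousSubmodule J ℂ d →ₗ[ℂ] symPowDual W d where
  toFun F := ⟨fun v => MvPolynomial.eval (v : J → ℂ) F.1,
    eval_mem_symPowDual W ((MvPolynomial.mem_homogeneousSubmodule d F.1).1 F.2)⟩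
  map_add' F G := by ext; simp
  map_smul' c F := by ext; simp [MvPolynomial.smul_eval]

theorem dual_sub_coord_regular (T : X.Pt → Submodule ℂ (J → ℂ)) (j : J) (x : X.Pt) :
    (sub T).dual.RegularAt
      (fun y => (LinearMap.proj j : (J → ℂ) →ₗ[ℂ] ℂ) ∘ₗ (T y).subtype) x := by
  refine .of_forall fun y s hs => ?_
  obtain ⟨k, f, g, hf, hg, h⟩ := hs
  choose a ha using hg
  have : X.RegularAt (fun z => ∑ i, f i z * a i j) y :=
    RegularAt.sum fun i => (hf i).mul (regularAt_const _ _)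
  refine this.congr (h.mono fun z hz => ?_)
  refine (congrFun hz j).trans ?_
  simp [ha]

theorem restrict_regular (T : X.Pt → Submodule ℂ (J → ℂ)) (d : ℕ)
    (F : MvPolynomial.homogeneousSubmodule J ℂ d) (x : X.Pt) :
    ((sub T).symDual d).RegularAt (fun y => restrict (T y) d F) x := by
  obtain ⟨F, hF⟩ := F
  have hF' := (MvPolynomial.mem_homogeneousSubmodule d F).1 hF
  have hm : ∀ m : F.support, ∃ l : Fin d → J, ∀ v : J → ℂ,
      MvPolynomial.eval v (MvPolynomial.monomial m.1 (F.coeff m)) =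
        F.coeff m * ∏ i, v (l i) := fun m =>
    eval_monomial_eq_prod m.1
      (by rw [Finsupp.degree_eq_weight_one]; exact hF' (MvPolynomial.mem_support_iff.1 m.2)) _
  choose l hl using hm
  let e := F.support.equivFin
  have hmem : ∀ (i : Fin F.support.card) (y : X.Pt),
      (fun v : T y => ∏ j, ((LinearMap.proj (l (e.symm i) j) : (J → ℂ) →ₗ[ℂ] ℂ) ∘ₗ
        (T y).subtype) v) ∈ symPowDual (T y) d :=
    fun i y => Submodule.subset_span ⟨_, rfl⟩
  refine ⟨F.support.card, fun i _ => F.coeff (e.symm i).1, fun i y => ⟨_, hmem i y⟩,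
    fun i => regularAt_const _ _, fun i => ⟨_, fun j => dual_sub_coord_regular T _ x,
      fun y => rfl⟩, .of_forall fun y => ?_⟩
  apply Subtype.ext
  funext v
  change MvPolynomial.eval (v : J → ℂ) F = _
  conv_lhs => rw [← MvPolynomial.support_sum_monomial_coeff F]
  rw [map_sum, ← Finset.sum_coe_sort, ← e.symm.sum_comp]
  simp [hl, Finset.sum_apply]

/-- The evaluation map `S^d ⊗ 𝒪_X → Sym^d (T^∨)`, where `S^d` is the space of homogeneous polynomials
of degree `d` on `ℂ^J` and `T` is a family of linear subspaces of `ℂ^J`: at the point `x` a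
polynomial is restricted to `T x`. -/
def evaluation (T : X.Pt → Submodule ℂ (J → ℂ)) (d : ℕ) :
    Hom (trivial X (MvPolynomial.homogeneousSubmodule J ℂ d)) ((sub T).symDual d) where
  map x := restrict (T x) d
  regular := by
    rintro s x ⟨k, f, g, hf, hg, h⟩
    choose a ha using hg
    have hsum := ((sub T).symDual d).sum fun i =>
      ((sub T).symDual d).smul (hf i) (restrict_regular T d (a i) x)
    refine ((sub T).symDual d).congr hsum (h.mono fun y hy => ?_)
    refine (congrArg (restrict (T y) d) hy).trans ?_
    rw [map_sum]
    simp only [map_smul, ha]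

end AlgBundle

namespace EmbeddedVariety

/-- The line bundle `𝒪_X(1)` of the projective embedding: the dual of the restriction to `X` of the
tautological line subbundle on the ambient projective space. -/
abbrev twistOne (X : EmbeddedVariety) : AlgBundle X :=
  (AlgBundle.sub fun x => (X.emb x).submodule).dual

end EmbeddedVariety

/-- The projective space `ℙⁿ`, of lines through `0` in `ℂ^{n+1}`. -/
def projectiveSpace (n : ℕ) : EmbeddedVariety where
  Pt := ℙ ℂ (Fin (n + 1) → ℂ)
  Coord := Fin (n + 1)
  emb := id
  emb_injective := Function.injective_id

/-- The Plücker coordinates `p_{ij} = u_i v_j - u_j v_i` of a pair of vectors (for all `i`, `j`). -/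
def pluckerCoord {J : Type} (u v : J → ℂ) : J × J → ℂ :=
  fun p => u p.1 * v p.2 - u p.2 * v p.1

theorem span_pluckerCoord {J : Type} {u v : J → ℂ} (h : pluckerCoord u v ≠ 0) :
    Submodule.span ℂ (Set.range fun i j => pluckerCoord u v (i, j)) = Submodule.span ℂ {u, v} := by
  apply le_antisymm
  · rw [Submodule.span_le]
    rintro _ ⟨i, rfl⟩
    refine Submodule.mem_span_pair.2 ⟨-v i, u i, ?_⟩
    funext j
    simp [pluckerCoord]
    ring
  · obtain ⟨⟨i, j⟩, hij⟩ := Function.ne_iff.1 h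
    have hi : (fun k => pluckerCoord u v (i, k)) ∈
        Submodule.span ℂ (Set.range fun i j => pluckerCoord u v (i, j)) :=
      Submodule.subset_span ⟨i, rfl⟩
    have hj : (fun k => pluckerCoord u v (j, k)) ∈
        Submodule.span ℂ (Set.range fun i j => pluckerCoord u v (i, j)) :=
      Submodule.subset_span ⟨j, rfl⟩
    have hij' : u i * v j - u j * v i ≠ 0 := hij
    have key : ∀ w : J → ℂ, (u i * v j - u j * v i) • w =
        w j • (fun k => pluckerCoord u v (i, k)) - w i • (fun k => pluckerCoord u v (j, k)) →
        w ∈ Submodule.span ℂ (Set.range fun i j => pluckerCoord u v (i, j)) := by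
      intro w hw
      have := Submodule.smul_mem _ (u i * v j - u j * v i)⁻¹
        (Submodule.sub_mem _ (Submodule.smul_mem _ (w j) hi) (Submodule.smul_mem _ (w i) hj))
      rwa [← hw, smul_smul, inv_mul_cancel₀ hij', one_smul] at this
    rw [Submodule.span_le]
    intro w hw
    apply key
    rcases hw with rfl | hw
    · funext k
      simp [pluckerCoord]
      ring
    · rw [Set.mem_singleton_iff.1 hw]
      funext k
      simp [pluckerCoord]
      ring

theorem pluckerCoord_ne_zero {J : Type} {u v : J → ℂ} (h : LinearIndependent ℂ ![u, v]) :
    pluckerCoord u v ≠ 0 := by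
  intro h0
  rw [LinearIndependent.pair_iff] at h
  have hv : v = 0 := by
    by_contra hv
    obtain ⟨j, hj⟩ := Function.ne_iff.1 hv
    refine hj (h (v j) (-u j) ?_).1
    funext i
    have := congrFun h0 (i, j)
    simp [pluckerCoord] at this ⊢
    linear_combination this
  simpa using h 0 1 (by simp [hv])

/-- The set of lines in `ℙⁿ`, that is, of two-dimensional linear subspaces of `ℂ^{n+1}`. -/
abbrev LineIn (n : ℕ) : Type :=
  {W : Submodule ℂ (Fin (n + 1) → ℂ) // Module.finrank ℂ W = 2}

namespace LineIn

variable {n : ℕ}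

/-- A basis of the two-dimensional space underlying a line. -/
def basis (W : LineIn n) : Module.Basis (Fin 2) ℂ W.1 :=
  Module.finBasisOfFinrankEq ℂ W.1 W.2

theorem span_basis (W : LineIn n) :
    Submodule.span ℂ {(W.basis 0 : Fin (n + 1) → ℂ), (W.basis 1 : Fin (n + 1) → ℂ)} = W.1 := by
  have h := congrArg (Submodule.map W.1.subtype) W.basis.span_eq
  rw [Submodule.map_span, Submodule.map_subtype_top, ← Set.range_comp] at h
  refine Eq.trans ?_ h
  congr 1
  ext w
  simp [Fin.exists_fin_two, eq_comm]

theorem plucker_ne_zero (W : LineIn n) :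
    pluckerCoord (W.basis 0 : Fin (n + 1) → ℂ) (W.basis 1 : Fin (n + 1) → ℂ) ≠ 0 := by
  apply pluckerCoord_ne_zero
  have h := W.basis.linearIndependent.map' W.1.subtype (Submodule.ker_subtype _)
  have h2 : (![(W.basis 0 : Fin (n + 1) → ℂ), (W.basis 1 : Fin (n + 1) → ℂ)]) =
      W.1.subtype ∘ W.basis := by
    funext i
    fin_cases i <;> rfl
  rw [h2]
  exact h

/-- The Plücker map: the point of projective space whose homogeneous coordinates are the Plücker
coordinates of a basis of the two-dimensional space (another basis changes them by a nonzero
factor). -/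
def plucker (W : LineIn n) : ℙ ℂ (Fin (n + 1) × Fin (n + 1) → ℂ) :=
  Projectivization.mk ℂ (pluckerCoord (W.basis 0 : Fin (n + 1) → ℂ) (W.basis 1 : Fin (n + 1) → ℂ))
    W.plucker_ne_zero

theorem plucker_injective : Function.Injective (plucker (n := n)) := by
  intro W W' h
  obtain ⟨a, ha⟩ := (Projectivization.mk_eq_mk_iff _ _ _ _ _).1 h
  apply Subtype.ext
  have h1 := span_pluckerCoord W.plucker_ne_zero
  have h2 := span_pluckerCoord W'.plucker_ne_zero
  rw [span_basis] at h1 h2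
  refine h1.symm.trans (Eq.trans ?_ h2)
  rw [← ha]
  apply le_antisymm
  · rw [Submodule.span_le]
    rintro _ ⟨i, rfl⟩
    exact Submodule.smul_mem _ (a : ℂ) (Submodule.subset_span ⟨i, rfl⟩)
  · rw [Submodule.span_le]
    rintro _ ⟨i, rfl⟩
    have := Submodule.smul_mem _ ((a⁻¹ : ℂˣ) : ℂ) (Submodule.subset_span (R := ℂ)
      (Set.mem_range_self (f := fun i j => (a • pluckerCoord (W'.basis 0 : Fin (n + 1) → ℂ)
        (W'.basis 1 : Fin (n + 1) → ℂ)) (i, j)) i))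
    have h3 : (fun j => pluckerCoord (W'.basis 0 : Fin (n + 1) → ℂ) (W'.basis 1) (i, j)) =
        ((a⁻¹ : ℂˣ) : ℂ) • fun j => (a • pluckerCoord (W'.basis 0 : Fin (n + 1) → ℂ)
          (W'.basis 1 : Fin (n + 1) → ℂ)) (i, j) := by
      funext j
      simp [Units.smul_def]
    exact (congrArg (· ∈ Submodule.span ℂ _) h3).mpr this

end LineIn

/-- The Grassmannian of lines in `ℙⁿ`, with its Plücker embedding. -/
def grassmannianOfLines (n : ℕ) : EmbeddedVariety where
  Pt := LineIn n
  Coord := Fin (n + 1) × Fin (n + 1)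
  emb := LineIn.plucker
  emb_injective := LineIn.plucker_injective

/-- `M^d` on `ℙⁿ`: the kernel of the evaluation map `S^d ⊗ 𝒪 → 𝒪(d)`, where `𝒪(d) = Sym^d 𝒪(1)` and
`𝒪(1)` is the dual of the tautological line subbundle of `ℂ^{n+1} ⊗ 𝒪`. -/
abbrev kernelBundleProj (n d : ℕ) : AlgBundle (projectiveSpace n) :=
  AlgBundle.ker (AlgBundle.evaluation
    (fun x : (projectiveSpace n).Pt => Projectivization.submodule (K := ℂ) (V := Fin (n + 1) → ℂ) x)
    d)

/-- `M^d` on the Grassmannian of lines: the kernel of the evaluation map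
`S^d ⊗ 𝒪_G → Sym^d (𝒮^∨)`, where `𝒮 ⊆ ℂ^{n+1} ⊗ 𝒪_G` is the tautological subbundle of rank two. -/
abbrev kernelBundleGrass (n d : ℕ) : AlgBundle (grassmannianOfLines n) :=
  AlgBundle.ker (AlgBundle.evaluation (fun W : (grassmannianOfLines n).Pt => Subtype.val W) d)

end

open scoped LinearAlgebra.Projectivization TensorProduct Topology
open MvPolynomial EmbeddedVariety

noncomputable section

/-! Both statements follow from one principle (`globallyGenerated_ker_evaluation`). Suppose the
subspaces `T y` of `ℂ^J` are cut out by linear forms `L α` whose coefficients are themselves linear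
in the homogeneous coordinates `r` of `y`. For a form `A` of degree `d - 1`, the product `A * L α r`
vanishes on `T y` and is linear in `r`, so it is a global section of the kernel twisted by `𝒪(1)`:
the factor gained by rescaling `r` is absorbed by the twist (`twistedSection_eq`).

These sections generate. On the chart where the coordinate `c` is nonzero, the substitution `π : X j
↦ X j - L (a j)` is composition with a linear map `ℂ^J → T y`, so `π F = 0` for every form `F`
vanishing on `T y` (`eliminate_eq_zero`). Hence `F = F - π F`, and induction on the degree writes `F
- π F` as a combination of products `A * L α` with regular coefficients
(`multiples_eliminationError`). As this works for every `F`, in the kernel or not, it applies both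
to germs of sections and to single fibres.

On `ℙⁿ` the equations are the `2 × 2` minors of the matrix with rows `X`, `r`. On the Grassmannian
they are the `3 × 3` minors of the matrix with rows `X`, `u`, `v`, where `u`, `v` span the plane;
their coefficients are Plücker coordinates. -/

namespace EmbeddedVariety

/-! ### Standard affine charts. -/

variable {X : EmbeddedVariety}

/-- The homogeneous coordinates of `y`, scaled so that the coordinate `c` is `1` (and zero if that
coordinate vanishes at `y`). -/
def affineCoord (X : EmbeddedVariety) (c : X.Coord) (y : X.Pt) : X.Coord → ℂ :=
  ((X.emb y).rep c)⁻¹ • (X.emb y).rep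

theorem value_X (c : X.Coord) (y : X.Pt) : X.value (MvPolynomial.X c) y = (X.emb y).rep c := by
  simp [value]

theorem eventually_rep_ne_zero {c : X.Coord} {x : X.Pt} (hx : (X.emb x).rep c ≠ 0) :
    ∀ᶠ y in 𝓝 x, (X.emb y).rep c ≠ 0 := by
  have h := eventually_value_ne_zero (X := X) (isHomogeneous_X ℂ c) (x := x)
    (by rwa [value_X])
  simpa only [value_X] using h

theorem exists_rep_ne_zero (x : X.Pt) : ∃ c, (X.emb x).rep c ≠ 0 :=
  Function.ne_iff.1 (X.emb x).rep_nonzero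

theorem regularAt_affineCoord {c : X.Coord} {x : X.Pt} (hx : (X.emb x).rep c ≠ 0)
    (c' : X.Coord) : X.RegularAt (fun y => X.affineCoord c y c') x := by
  refine ⟨1, MvPolynomial.X c', MvPolynomial.X c, isHomogeneous_X ℂ c', isHomogeneous_X ℂ c,
    by rwa [value_X], .of_forall fun y => ?_⟩
  simp [affineCoord, value_X, div_eq_inv_mul]

theorem rep_mem_submodule (y : X.Pt) : (X.emb y).rep ∈ (X.emb y).submodule := by
  rw [Projectivization.submodule_eq]
  exact Submodule.mem_span_singleton_self _

end EmbeddedVariety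

/-! ### Sections linear in the coordinates, and the trivialization of `𝒪_X(1)` on a chart. -/

namespace AlgBundle

variable {X : EmbeddedVariety}

/-- Expanding in the standard basis gives constant vectors `L (e_i)` with the regular coefficients
`affineCoord c y i`. -/
theorem trivial_regularAt_linear [Fintype X.Coord] {A : Type} [AddCommGroup A] [Module ℂ A]
    (L : (X.Coord → ℂ) →ₗ[ℂ] A) {c : X.Coord} {x : X.Pt} (hx : (X.emb x).rep c ≠ 0) :
    (trivial X A).RegularAt (fun y => L (X.affineCoord c y)) x := by
  classical
  let e := Fintype.equivFin X.Coord
  refine ⟨Fintype.card X.Coord, fun i y => X.affineCoord c y (e.symm i),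
    fun i _ => L (Pi.single (e.symm i) 1), fun i => regularAt_affineCoord hx _,
    fun i => ⟨_, fun _ => rfl⟩, .of_forall fun y => ?_⟩
  change L (X.affineCoord c y) = ∑ i, X.affineCoord c y (e.symm i) • L (Pi.single (e.symm i) 1)
  rw [L.pi_apply_eq_sum_univ, ← e.symm.sum_comp]
  refine Finset.sum_congr rfl fun i _ => ?_
  congr 2
  funext j
  simp [Pi.single_apply, eq_comm]

/-- The coordinate `c`, as a section of `𝒪_X(1)`. -/
def coordSection (c : X.Coord) (y : X.Pt) : X.twistOne.Fiber y :=
  (LinearMap.proj c : (X.Coord → ℂ) →ₗ[ℂ] ℂ) ∘ₗ (X.emb y).submodule.subtype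

theorem coordSection_regularAt (c : X.Coord) (x : X.Pt) :
    X.twistOne.RegularAt (coordSection c) x :=
  dual_sub_coord_regular (fun x => (X.emb x).submodule) c x

/-- The section `affineCoord c` of the tautological line bundle. -/
def tautSection (c : X.Coord) (y : X.Pt) : (X.emb y).submodule :=
  ⟨X.affineCoord c y, Submodule.smul_mem _ _ (rep_mem_submodule y)⟩

/-- The fibre of the tautological bundle is a line spanned by `tautSection c y`, on which the
coordinate `c` takes the value `1`. -/
theorem eq_smul_coordSection {c : X.Coord} {y : X.Pt} (hy : (X.emb y).rep c ≠ 0)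
    (φ : X.twistOne.Fiber y) : φ = φ (tautSection c y) • coordSection c y := by
  refine LinearMap.ext fun w => ?_
  obtain ⟨a, ha⟩ : ∃ a : ℂ, a • (X.emb y).rep = (w : X.Coord → ℂ) := by
    have h : (w : X.Coord → ℂ) ∈ (X.emb y).submodule := w.2
    rw [Projectivization.submodule_eq] at h
    exact Submodule.mem_span_singleton.1 h
  have hw : w = (a * (X.emb y).rep c) • tautSection c y := by
    apply Subtype.ext
    rw [← ha]
    funext j
    simp [tautSection, affineCoord]
    field_simp
  have hc : coordSection c y w = a * (X.emb y).rep c := by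
    change (w : X.Coord → ℂ) c = _
    rw [← ha]
    rfl
  rw [LinearMap.smul_apply, hc, smul_eq_mul, mul_comm]
  conv_lhs => rw [hw, map_smul, smul_eq_mul]

theorem coordSection_eq_smul {c : X.Coord} {y : X.Pt} (hy : (X.emb y).rep c ≠ 0) (c' : X.Coord) :
    coordSection c' y = X.affineCoord c y c' • coordSection c y :=
  eq_smul_coordSection hy _

/-- The coefficient `f` is the value of `t` on `tautSection c`. It is regular because `tautSection
c` is a regular section near `x` and regular sections of the dual send such sections to regular
functions. -/
theorem twistOne_eventually_eq_smul [Fintype X.Coord] {c : X.Coord} {x : X.Pt}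
    (hx : (X.emb x).rep c ≠ 0) {t : ∀ y, X.twistOne.Fiber y} (ht : X.twistOne.RegularAt t x) :
    ∃ f : X.Pt → ℂ, X.RegularAt f x ∧ ∀ᶠ y in 𝓝 x, t y = f y • coordSection c y := by
  refine ⟨fun y => t y (tautSection c y), ?_, ?_⟩
  · exact ht.self_of_nhds (tautSection c) (trivial_regularAt_linear LinearMap.id hx)
  · filter_upwards [eventually_rep_ne_zero hx] with y hy
    exact eq_smul_coordSection hy _

/-! ### Linear equations and elimination modulo them. -/

variable {J I : Type}

/-- The linear forms `L α` in the homogeneous coordinates of `X`, with values linear forms on `ℂ^J`,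
are equations for the family of linear subspaces `T`: they vanish on `T y`, and on each standard
chart of `X` they contain the equations of the image of a projection to `T y`. -/
structure IsLinearEquations (T : X.Pt → Submodule ℂ (J → ℂ))
    (L : I → (X.Coord → ℂ) →ₗ[ℂ] MvPolynomial J ℂ) : Prop where
  homogeneous : ∀ α r, (L α r).IsHomogeneous 1
  vanish : ∀ α y, ∀ v ∈ T y, eval v (L α (X.emb y).rep) = 0
  chart : ∀ c : X.Coord, ∃ a : J → I, ∀ y, (X.emb y).rep c ≠ 0 → ∀ v : J → ℂ,
    (fun j => v j - eval v (L (a j) (X.affineCoord c y))) ∈ T y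

/-- The multiples of degree `d` of the equations `L α` in the chart `c`, as a sheaf of sections of the
trivial family of polynomials. -/
abbrev multiples (L : I → (X.Coord → ℂ) →ₗ[ℂ] MvPolynomial J ℂ) (c : X.Coord) (d : ℕ) :
    AlgBundle X :=
  generated (fun _ => MvPolynomial J ℂ)
    (fun g _ => ∃ (e : ℕ) (A : MvPolynomial J ℂ) (α : I), e + 1 = d ∧ A.IsHomogeneous e ∧
      ∀ y, g y = A * L α (X.affineCoord c y)) fun _ _ h => .of_forall fun _ => h

theorem multiples_mul {L : I → (X.Coord → ℂ) →ₗ[ℂ] MvPolynomial J ℂ} {c : X.Coord} {d : ℕ}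
    {g : X.Pt → MvPolynomial J ℂ} {x : X.Pt} (hg : (multiples L c d).RegularAt g x)
    {P : MvPolynomial J ℂ} (hP : P.IsHomogeneous 1) :
    (multiples L c (d + 1)).RegularAt (fun y => P * g y) x := by
  obtain ⟨k, f, g', hf, hg', h⟩ := hg
  refine ⟨k, f, fun i y => P * g' i y, hf, fun i => ?_, h.mono fun y hy => ?_⟩
  · obtain ⟨e, A, α, he, hA, h'⟩ := hg' i
    exact ⟨e + 1, P * A, α, by omega, by simpa [add_comm] using hP.mul hA,
      fun y => by simp only [h', mul_assoc]⟩
  · simp only [hy, Finset.mul_sum, mul_smul_comm]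

/-- The factor `L α (affineCoord c y)` varies with `y`, whereas the cofactors `A` in `multiples`
must be constant. By linearity it is a combination, with regular coefficients, of the constant forms
`L α (e_i)`, to which `multiples_mul` applies. -/
theorem multiples_mul_linear [Fintype X.Coord] {L : I → (X.Coord → ℂ) →ₗ[ℂ] MvPolynomial J ℂ}
    (hL : ∀ α r, (L α r).IsHomogeneous 1) {c : X.Coord} {d : ℕ} {g : X.Pt → MvPolynomial J ℂ}
    {x : X.Pt} (hx : (X.emb x).rep c ≠ 0) (hg : (multiples L c d).RegularAt g x) (α : I) :
    (multiples L c (d + 1)).RegularAt (fun y => L α (X.affineCoord c y) * g y) x := by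
  classical
  let e := Fintype.equivFin X.Coord
  refine (multiples L c (d + 1)).congr
    ((multiples L c (d + 1)).sum (k := Fintype.card X.Coord) fun i =>
      (multiples L c (d + 1)).smul (regularAt_affineCoord hx (e.symm i))
        (multiples_mul hg (hL α (fun j => if e.symm i = j then 1 else 0))))
    (.of_forall fun y => ?_)
  conv_lhs => rw [(L α).pi_apply_eq_sum_univ, Finset.sum_mul, ← e.symm.sum_comp]
  simp only [smul_mul_assoc]

/-- The substitution `X j ↦ X j - L (a j)` in the chart `c`. -/
def eliminate (L : I → (X.Coord → ℂ) →ₗ[ℂ] MvPolynomial J ℂ) (a : J → I) (c : X.Coord) (y : X.Pt) :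
    MvPolynomial J ℂ →ₐ[ℂ] MvPolynomial J ℂ :=
  aeval fun j => MvPolynomial.X j - L (a j) (X.affineCoord c y)

/-- The change of `F` under the substitution `eliminate`. -/
def eliminationError (L : I → (X.Coord → ℂ) →ₗ[ℂ] MvPolynomial J ℂ) (a : J → I) (c : X.Coord)
    (F : MvPolynomial J ℂ) (y : X.Pt) : MvPolynomial J ℂ :=
  F - eliminate L a c y F

/-- Induction on the degree, splitting off one variable: a product changes under the substitution by
a sum of terms, each containing either the change of the shorter monomial or the equation `L (a i)`.
-/
theorem multiples_eliminationError_monomial [Fintype X.Coord]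
    {L : I → (X.Coord → ℂ) →ₗ[ℂ] MvPolynomial J ℂ} (hL : ∀ α r, (L α r).IsHomogeneous 1)
    {c : X.Coord} {x : X.Pt} (hx : (X.emb x).rep c ≠ 0) (a : J → I) (d : ℕ) :
    ∀ m : J →₀ ℕ, m.degree = d →
      (multiples L c d).RegularAt (eliminationError L a c (monomial m 1)) x := by
  classical
  induction d with
  | zero =>
    intro m hm
    obtain rfl := (Finsupp.degree_eq_zero_iff m).1 hm
    exact (multiples L c 0).congr ((multiples L c 0).zero x) (.of_forall fun y => by
      simp [eliminationError])
  | succ d ih =>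
    intro m hm
    obtain ⟨i, hi⟩ : ∃ i, m i ≠ 0 := by
      by_contra! h
      have : m = 0 := Finsupp.ext h
      simp [this] at hm
    obtain ⟨m', rfl⟩ : ∃ m', m = Finsupp.single i 1 + m' :=
      ⟨m - Finsupp.single i 1, (add_tsub_cancel_of_le (by
        rw [Finsupp.single_le_iff]; omega)).symm⟩
    have hm' : m'.degree = d := by
      simp at hm
      omega
    -- With `E = m' - π m'` and `l = L (a i)`, this is `X i * m' - (X i - l) * (m' - E) = X i * E -
    -- l * E + m' * l`.
    have key : ∀ y, eliminationError L a c (monomial (Finsupp.single i 1 + m') 1) y =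
        MvPolynomial.X i * eliminationError L a c (monomial m' 1) y +
          (-1 : ℂ) • (L (a i) (X.affineCoord c y) * eliminationError L a c (monomial m' 1) y) +
          monomial m' 1 * L (a i) (X.affineCoord c y) := by
      intro y
      have hX : eliminate L a c y (MvPolynomial.X i) =
          MvPolynomial.X i - L (a i) (X.affineCoord c y) := aeval_X _ _
      have hmm : (monomial (Finsupp.single i 1 + m') 1 : MvPolynomial J ℂ) =
          MvPolynomial.X i * monomial m' 1 := by
        rw [MvPolynomial.X, monomial_mul, one_mul]
      rw [eliminationError, eliminationError, hmm, map_mul, hX, neg_smul, one_smul]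
      ring
    have h1 := multiples_mul (ih m' hm') (isHomogeneous_X ℂ i)
    have h2 := multiples_mul_linear hL hx (ih m' hm') (a i)
    have h3 : (multiples L c (d + 1)).RegularAt
        (fun y => monomial m' 1 * L (a i) (X.affineCoord c y)) x :=
      ⟨1, fun _ _ => 1, fun _ y => monomial m' 1 * L (a i) (X.affineCoord c y),
        fun _ => regularAt_const 1 x,
        fun _ => ⟨d, _, a i, rfl, isHomogeneous_monomial _ hm', fun _ => rfl⟩, by simp⟩
    exact (multiples L c (d + 1)).congr ((multiples L c (d + 1)).add
      ((multiples L c (d + 1)).add h1 ((multiples L c (d + 1)).smul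
        (regularAt_const (-1) x) h2)) h3)
      (.of_forall key)

/-- The substitution `X j ↦ X j - L (a j)` changes a form by a multiple of the equations. -/
theorem multiples_eliminationError [Fintype X.Coord] {L : I → (X.Coord → ℂ) →ₗ[ℂ] MvPolynomial J ℂ}
    (hL : ∀ α r, (L α r).IsHomogeneous 1) {c : X.Coord} {x : X.Pt}
    (hx : (X.emb x).rep c ≠ 0) (a : J → I) {d : ℕ} {F : MvPolynomial J ℂ}
    (hF : F.IsHomogeneous d) :
    (multiples L c d).RegularAt (eliminationError L a c F) x := by
  let e := F.support.equivFin
  have hF' : F = ∑ i : Fin F.support.card, F.coeff (e.symm i).1 • monomial (e.symm i).1 1 := by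
    conv_lhs => rw [← support_sum_monomial_coeff F]
    rw [← Finset.sum_coe_sort, ← e.symm.sum_comp]
    simp [smul_monomial]
  have key : ∀ y, eliminationError L a c F y =
      ∑ i : Fin F.support.card, F.coeff (e.symm i).1 •
        eliminationError L a c (monomial (e.symm i).1 1) y := by
    intro y
    simp only [eliminationError, smul_sub, Finset.sum_sub_distrib, ← map_smul (eliminate L a c y),
      ← map_sum (eliminate L a c y)]
    rw [← hF']
  exact (multiples L c d).congr ((multiples L c d).sum (k := F.support.card) fun i =>
    (multiples L c d).smul (regularAt_const (F.coeff (e.symm i).1) x)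
      (multiples_eliminationError_monomial hL hx a d (e.symm i).1 (by
        rw [Finsupp.degree_eq_weight_one]; exact hF (mem_support_iff.1 (e.symm i).2))))
    (.of_forall key)

/-- The substituted polynomial is `F` composed with a map into `T y`, where `F` vanishes; over `ℂ` a
polynomial with all values zero is zero. -/
theorem eliminate_eq_zero {T : X.Pt → Submodule ℂ (J → ℂ)}
    {L : I → (X.Coord → ℂ) →ₗ[ℂ] MvPolynomial J ℂ} {c : X.Coord} {a : J → I} {y : X.Pt}
    (ha : ∀ v : J → ℂ, (fun j => v j - eval v (L (a j) (X.affineCoord c y))) ∈ T y)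
    {d : ℕ} {F : homogeneousSubmodule J ℂ d} (hF : restrict (T y) d F = 0) :
    eliminate L a c y F.1 = 0 := by
  refine MvPolynomial.funext fun v => ?_
  have h : eval (fun j => v j - eval v (L (a j) (X.affineCoord c y))) F.1 = 0 :=
    congrFun (congrArg Subtype.val hF) ⟨_, ha v⟩
  rw [map_zero, ← h]
  change aeval v (aeval _ F.1) = aeval _ F.1
  rw [← AlgHom.comp_apply, comp_aeval]
  congr 2
  funext j
  simp [aeval_eq_eval]

/-! ### Sections of the kernel of evaluation and of its twist. -/

section kernel

variable {T : X.Pt → Submodule ℂ (J → ℂ)} {L : I → (X.Coord → ℂ) →ₗ[ℂ] MvPolynomial J ℂ} {d e : ℕ}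

/-- The multiple `A * L α` of an equation, dehomogenized in the chart `c`, as a section of the kernel
of the evaluation map. -/
def equationSection (hL : IsLinearEquations T L) (he : e + 1 = d)
    (A : homogeneousSubmodule J ℂ e) (α : I) (c : X.Coord) (y : X.Pt) :
    (ker (evaluation T d)).Fiber y :=
  ⟨⟨A.1 * L α (X.affineCoord c y), (mem_homogeneousSubmodule _ _).2 (he ▸
      ((mem_homogeneousSubmodule _ _).1 A.2).mul (hL.homogeneous α _))⟩, by
    refine LinearMap.mem_ker.2 (Subtype.ext (funext fun v => ?_))
    change eval (v : J → ℂ) (A.1 * L α (X.affineCoord c y)) = 0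
    rw [map_mul, affineCoord, map_smul, smul_eval, hL.vanish α y v v.2, mul_zero, mul_zero]⟩

theorem equationSection_coe (hL : IsLinearEquations T L) (he : e + 1 = d)
    (A : homogeneousSubmodule J ℂ e) (α : I) (c : X.Coord) (y : X.Pt) :
    (equationSection hL he A α c y).1.1 = A.1 * L α (X.affineCoord c y) := rfl

theorem equationSection_regularAt [Fintype X.Coord] (hL : IsLinearEquations T L) (he : e + 1 = d)
    (A : homogeneousSubmodule J ℂ e) (α : I) {c : X.Coord} {x : X.Pt}
    (hx : (X.emb x).rep c ≠ 0) :
    (ker (evaluation T d)).RegularAt (equationSection hL he A α c) x := by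
  let M : (X.Coord → ℂ) →ₗ[ℂ] homogeneousSubmodule J ℂ d :=
    (LinearMap.mulLeft ℂ A.1 ∘ₗ L α).codRestrict _ fun r => (mem_homogeneousSubmodule _ _).2 (he ▸
      ((mem_homogeneousSubmodule _ _).1 A.2).mul (hL.homogeneous α _))
  exact trivial_regularAt_linear M hx

/-- The factor `affineCoord c y c'` is the one picked up by `coordSection` in the change of chart;
it also keeps the identity true where the coordinate `c'` vanishes. -/
theorem equationSection_change (hL : IsLinearEquations T L) (he : e + 1 = d)
    (A : homogeneousSubmodule J ℂ e) (α : I) {c : X.Coord} {y : X.Pt}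
    (hy : (X.emb y).rep c ≠ 0) (c' : X.Coord) :
    X.affineCoord c y c' • equationSection hL he A α c' y =
      X.affineCoord c y c' • X.affineCoord c' y c • equationSection hL he A α c y := by
  apply Subtype.ext
  apply Subtype.ext
  change X.affineCoord c y c' • (A.1 * L α (X.affineCoord c' y)) =
    X.affineCoord c y c' • X.affineCoord c' y c • (A.1 * L α (X.affineCoord c y))
  simp only [affineCoord, map_smul, mul_smul_comm, smul_smul, Pi.smul_apply, smul_eq_mul]
  congr 1
  field_simp

/-- The global section of `ker ⊗ 𝒪_X(1)` defined by the multiple `A * L α` of an equation. -/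
def twistedSection (hL : IsLinearEquations T L) (he : e + 1 = d)
    (A : homogeneousSubmodule J ℂ e) (α : I) (y : X.Pt) :
    ((ker (evaluation T d)).tensor X.twistOne).Fiber y :=
  equationSection hL he A α (exists_rep_ne_zero y).choose y ⊗ₜ
    coordSection (exists_rep_ne_zero y).choose y

/-- Independence of the chart: passing from `c` to `c'` multiplies the two tensor factors by
mutually inverse ratios of coordinates. -/
theorem twistedSection_eq (hL : IsLinearEquations T L) (he : e + 1 = d)
    (A : homogeneousSubmodule J ℂ e) (α : I) {c : X.Coord} {y : X.Pt}
    (hy : (X.emb y).rep c ≠ 0) :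
    twistedSection hL he A α y = equationSection hL he A α c y ⊗ₜ coordSection c y := by
  have hc := (exists_rep_ne_zero y).choose_spec
  rw [twistedSection]
  generalize (exists_rep_ne_zero y).choose = c' at hc ⊢
  rw [coordSection_eq_smul hy c', ← TensorProduct.smul_tmul, equationSection_change _ _ _ _ hy,
    smul_smul]
  have : X.affineCoord c y c' * X.affineCoord c' y c = 1 := by
    simp only [affineCoord, Pi.smul_apply, smul_eq_mul]
    field_simp
  rw [this, one_smul]

theorem twistedSection_isGlobalSection [Fintype X.Coord] (hL : IsLinearEquations T L)
    (he : e + 1 = d) (A : homogeneousSubmodule J ℂ e) (α : I) :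
    ((ker (evaluation T d)).tensor X.twistOne).IsGlobalSection (twistedSection hL he A α) := by
  intro x
  obtain ⟨c, hc⟩ := exists_rep_ne_zero x
  refine ⟨1, fun _ _ => 1, fun _ y => equationSection hL he A α c y ⊗ₜ coordSection c y,
    fun _ => regularAt_const 1 x, fun _ => ⟨_, _, equationSection_regularAt hL he A α hc,
      coordSection_regularAt c x, fun _ => rfl⟩, ?_⟩
  filter_upwards [eventually_rep_ne_zero hc] with y hy
  rw [twistedSection_eq hL he A α hy]
  simp

/-- Near `x`, a regular section of the kernel of the evaluation map is a combination of multiples of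
the equations. -/
theorem ker_eventually_eq_sum [Fintype X.Coord] (hL : IsLinearEquations T L) {c : X.Coord}
    {x : X.Pt} (hx : (X.emb x).rep c ≠ 0) {s : ∀ y, (ker (evaluation T d)).Fiber y}
    (hs : (ker (evaluation T d)).RegularAt s x) :
    ∃ (k : ℕ) (f : Fin k → X.Pt → ℂ) (e : Fin k → ℕ) (he : ∀ i, e i + 1 = d)
      (A : ∀ i, homogeneousSubmodule J ℂ (e i)) (α : Fin k → I), (∀ i, X.RegularAt (f i) x) ∧
      ∀ᶠ y in 𝓝 x, s y = ∑ i, f i y • equationSection hL (he i) (A i) (α i) c y := by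
  obtain ⟨a, ha⟩ := hL.chart c
  have hs' : (multiples L c d).RegularAt (fun y => (s y).1.1) x := by
    obtain ⟨k, f, g, hf, hg, h⟩ := hs
    choose F hF using hg
    -- Locally `s = ∑ f i • F i` with constant forms `F i` that need not lie in the kernel. The
    -- combination of their errors is `s - π s`, and `π s = 0` because `s` itself lies in the
    -- kernel.
    refine (multiples L c d).congr ((multiples L c d).sum fun i => (multiples L c d).smul (hf i)
      (multiples_eliminationError hL.homogeneous hx a ((mem_homogeneousSubmodule _ _).1 (F i).2))) ?_
    filter_upwards [h, eventually_rep_ne_zero hx] with y h1 h2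
    have h3 : (s y).1.1 = ∑ i, f i y • (F i).1 := by
      have : (s y).1 = ∑ i, f i y • F i := by
        refine h1.trans (Finset.sum_congr rfl fun i _ => ?_)
        rw [hF]
      rw [this]
      simp
    have h4 := eliminate_eq_zero (ha y h2) (LinearMap.mem_ker.1 (s y).2)
    simp only [eliminationError, smul_sub, Finset.sum_sub_distrib, ← map_smul (eliminate L a c y),
      ← map_sum (eliminate L a c y)]
    rw [← h3, h4, sub_zero]
  obtain ⟨k, f, g, hf, hg, h⟩ := hs'
  choose e A α he hA hg using hg
  refine ⟨k, f, e, he, fun i => ⟨A i, (mem_homogeneousSubmodule _ _).2 (hA i)⟩, α, hf, ?_⟩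
  filter_upwards [h] with y hy
  apply Subtype.ext
  apply Subtype.ext
  simp only [AddSubmonoidClass.coe_finsetSum, SetLike.val_smul, equationSection_coe]
  refine hy.trans (Finset.sum_congr rfl fun i _ => ?_)
  rw [hg]

/-- The pointwise analogue: the constant form `m` is in the kernel only at `x`, so the expansion of
its error is used there alone, with coefficients frozen at `x`. -/
theorem ker_eq_sum [Fintype X.Coord] (hL : IsLinearEquations T L) {c : X.Coord}
    {x : X.Pt} (hx : (X.emb x).rep c ≠ 0) (m : (ker (evaluation T d)).Fiber x) :
    ∃ (k : ℕ) (f : Fin k → ℂ) (e : Fin k → ℕ) (he : ∀ i, e i + 1 = d)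
      (A : ∀ i, homogeneousSubmodule J ℂ (e i)) (α : Fin k → I),
      m = ∑ i, f i • equationSection hL (he i) (A i) (α i) c x := by
  obtain ⟨a, ha⟩ := hL.chart c
  obtain ⟨k, f, g, -, hg, h⟩ := multiples_eliminationError hL.homogeneous hx a
    ((mem_homogeneousSubmodule _ _).1 m.1.2)
  choose e A α he hA hg using hg
  refine ⟨k, fun i => f i x, e, he, fun i => ⟨A i, (mem_homogeneousSubmodule _ _).2 (hA i)⟩, α, ?_⟩
  apply Subtype.ext
  apply Subtype.ext
  simp only [AddSubmonoidClass.coe_finsetSum, SetLike.val_smul, equationSection_coe]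
  have h1 : eliminationError L a c m.1.1 x = ∑ i, f i x • g i x := h.self_of_nhds
  rw [eliminationError, eliminate_eq_zero (ha x hx) (LinearMap.mem_ker.1 m.2), sub_zero] at h1
  refine h1.trans (Finset.sum_congr rfl fun i _ => ?_)
  rw [hg]

/-- If the family `T` of linear subspaces has linear equations whose coefficients are linear forms
in the homogeneous coordinates of `X`, then the kernel of `S^d ⊗ 𝒪_X → Sym^d (T^∨)`, twisted by
`𝒪_X(1)`, is generated by its global sections. -/
theorem globallyGenerated_ker_evaluation [Fintype X.Coord] (hL : IsLinearEquations T L) :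
    ((ker (evaluation T d)).tensor X.twistOne).GloballyGenerated := by
  let E := (ker (evaluation T d)).tensor X.twistOne
  -- Regularity for `G` is by definition the germ condition of global generation, so closure under
  -- sums and regular multiples comes with the bundle structure.
  let G : AlgBundle X := generated E.Fiber (fun g _ => E.IsGlobalSection g)
    fun _ _ h => .of_forall fun _ => h
  refine ⟨fun x s hs => ?_, fun x v => ?_⟩
  · change G.RegularAt s x
    obtain ⟨c, hc⟩ := exists_rep_ne_zero x
    obtain ⟨k, f, g, hf, hg, h⟩ := hs
    refine G.congr (G.sum fun i => G.smul (hf i) ?_) h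
    obtain ⟨s', t', hs', ht', hg⟩ := hg i
    obtain ⟨φ, hφ, h1⟩ := twistOne_eventually_eq_smul hc ht'
    obtain ⟨k', f', e, he, A, α, hf', h2⟩ := ker_eventually_eq_sum hL hc hs'
    have hgen : ∀ i, G.RegularAt (twistedSection hL (he i) (A i) (α i)) x := fun i =>
      ⟨1, fun _ _ => 1, fun _ => twistedSection hL (he i) (A i) (α i), fun _ => regularAt_const 1 x,
        fun _ => twistedSection_isGlobalSection hL (he i) (A i) (α i), by simp⟩
    refine G.congr (G.sum fun i => G.smul (hφ.mul (hf' i)) (hgen i)) ?_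
    filter_upwards [h1, h2, eventually_rep_ne_zero hc] with y h3 h4 h5
    rw [hg, h3, h4, TensorProduct.sum_tmul]
    refine Finset.sum_congr rfl fun i _ => ?_
    rw [twistedSection_eq hL _ _ _ h5, TensorProduct.tmul_smul, ← TensorProduct.smul_tmul', smul_smul]
  · change ∃ s, E.IsGlobalSection s ∧ s x = v
    obtain ⟨c, hc⟩ := exists_rep_ne_zero x
    induction v using TensorProduct.induction_on with
    | zero => exact ⟨fun _ => 0, E.zero, rfl⟩
    | add v w hv hw =>
      obtain ⟨s, hs, rfl⟩ := hv
      obtain ⟨t, ht, rfl⟩ := hw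
      exact ⟨fun y => s y + t y, fun y => E.add (hs y) (ht y), rfl⟩
    | tmul m t =>
      obtain ⟨k, f, e, he, A, α, hm⟩ := ker_eq_sum hL hc m
      -- `t (tautSection c x)` is the coordinate of `t` in the basis `coordSection c x`. All
      -- coefficients are constants, so the combination stays a global section.
      refine ⟨fun y => ∑ i, (t (tautSection c x) * f i) • twistedSection hL (he i) (A i) (α i) y,
        fun y => E.sum fun i => E.smul (regularAt_const _ y)
          (twistedSection_isGlobalSection hL (he i) (A i) (α i) y), ?_⟩
      conv_rhs => rw [hm, eq_smul_coordSection hc t, TensorProduct.sum_tmul]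
      refine Finset.sum_congr rfl fun i _ => ?_
      rw [twistedSection_eq hL _ _ _ hc, TensorProduct.tmul_smul, ← TensorProduct.smul_tmul',
        smul_smul]

end kernel

end AlgBundle

/-! ### Equations of points of `ℙⁿ` and of lines in `ℙⁿ`. -/

/-- The linear forms `r j * X i - r i * X j`, the equations of the line spanned by `r`. -/
def lineEquation (J : Type) (p : J × J) : (J → ℂ) →ₗ[ℂ] MvPolynomial J ℂ where
  toFun r := r p.2 • X p.1 - r p.1 • X p.2
  map_add' r s := by simp only [Pi.add_apply]; module
  map_smul' a r := by simp only [Pi.smul_apply, smul_eq_mul, RingHom.id_apply]; module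

/-- The minors `r (j, k) * X i - r (i, k) * X j + r (i, j) * X k`, the equations of the plane with
Plücker coordinates `r`. -/
def planeEquation (J : Type) (p : J × J × J) : (J × J → ℂ) →ₗ[ℂ] MvPolynomial J ℂ where
  toFun r := r (p.2.1, p.2.2) • X p.1 - r (p.1, p.2.2) • X p.2.1 + r (p.1, p.2.1) • X p.2.2
  map_add' r s := by simp only [Pi.add_apply]; module
  map_smul' a r := by simp only [Pi.smul_apply, smul_eq_mul, RingHom.id_apply]; module

theorem isHomogeneous_smul_X {J : Type} (a : ℂ) (j : J) :
    (a • (X j : MvPolynomial J ℂ)).IsHomogeneous 1 := by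
  rw [smul_eq_C_mul]
  exact (isHomogeneous_X ℂ j).C_mul a

theorem isHomogeneous_lineEquation {J : Type} (p : J × J) (r : J → ℂ) :
    (lineEquation J p r).IsHomogeneous 1 :=
  (isHomogeneous_smul_X _ _).sub (isHomogeneous_smul_X _ _)

theorem isHomogeneous_planeEquation {J : Type} (p : J × J × J) (r : J × J → ℂ) :
    (planeEquation J p r).IsHomogeneous 1 :=
  ((isHomogeneous_smul_X _ _).sub (isHomogeneous_smul_X _ _)).add (isHomogeneous_smul_X _ _)

theorem eval_lineEquation {J : Type} (p : J × J) (r v : J → ℂ) :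
    eval v (lineEquation J p r) = r p.2 * v p.1 - r p.1 * v p.2 := by
  simp [lineEquation, smul_eval]

theorem eval_planeEquation {J : Type} (i j k : J) (r : J × J → ℂ) (v : J → ℂ) :
    eval v (planeEquation J (i, j, k) r) = r (j, k) * v i - r (i, k) * v j + r (i, j) * v k := by
  simp [planeEquation, smul_eval]

theorem eval_lineEquation_of_mem {J : Type} (p : J × J) {r v : J → ℂ}
    (hv : v ∈ Submodule.span ℂ {r}) : eval v (lineEquation J p r) = 0 := by
  obtain ⟨a, rfl⟩ := Submodule.mem_span_singleton.1 hv
  rw [eval_lineEquation]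
  simp only [Pi.smul_apply, smul_eq_mul]
  ring

/-- The vector is `(v c / r c) • r`, the projection of `v` to the line along the hyperplane where
coordinate `c` vanishes. -/
theorem sub_eval_lineEquation_mem {J : Type} {c : J} {r : J → ℂ} (hr : r c ≠ 0) (v : J → ℂ) :
    (fun i => v i - eval v (lineEquation J (i, c) ((r c)⁻¹ • r))) ∈ Submodule.span ℂ {r} := by
  refine Submodule.mem_span_singleton.2 ⟨v c / r c, funext fun i => ?_⟩
  rw [eval_lineEquation]
  simp only [Pi.smul_apply, smul_eq_mul]
  field_simp
  ring

/-- The value is the determinant of the columns `i`, `j`, `k` of the rows `w`, `u`, `v`. -/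
theorem eval_planeEquation_of_mem {J : Type} (i j k : J) {u v w : J → ℂ}
    (hw : w ∈ Submodule.span ℂ {u, v}) :
    eval w (planeEquation J (i, j, k) (pluckerCoord u v)) = 0 := by
  obtain ⟨a, b, rfl⟩ := Submodule.mem_span_pair.1 hw
  rw [eval_planeEquation]
  simp only [Pi.smul_apply, Pi.add_apply, smul_eq_mul, pluckerCoord]
  ring

/-- The result is the vector of the plane with the same coordinates `j` and `k` as `w`; Cramer's
rule gives its coefficients on `u` and `v`. -/
theorem sub_eval_planeEquation_mem {J : Type} {j k : J} {u v : J → ℂ}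
    (h : pluckerCoord u v (j, k) ≠ 0) (w : J → ℂ) :
    (fun i => w i - eval w (planeEquation J (i, j, k)
      ((pluckerCoord u v (j, k))⁻¹ • pluckerCoord u v))) ∈ Submodule.span ℂ {u, v} := by
  refine Submodule.mem_span_pair.2 ⟨(v k * w j - v j * w k) / pluckerCoord u v (j, k),
    (u j * w k - u k * w j) / pluckerCoord u v (j, k), funext fun i => ?_⟩
  rw [eval_planeEquation]
  simp only [Pi.smul_apply, Pi.add_apply, smul_eq_mul]
  field_simp
  simp only [pluckerCoord]
  ring

theorem isLinearEquations_projectiveSpace (n : ℕ) :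
    AlgBundle.IsLinearEquations (X := projectiveSpace n)
      (fun x : (projectiveSpace n).Pt =>
        Projectivization.submodule (K := ℂ) (V := Fin (n + 1) → ℂ) x)
      (lineEquation (Fin (n + 1))) where
  homogeneous := isHomogeneous_lineEquation
  vanish p y v hv := by
    exact eval_lineEquation_of_mem p
      ((Projectivization.submodule_eq (K := ℂ) (V := Fin (n + 1) → ℂ) y).le hv)
  chart c := by
    refine ⟨fun i => (i, c), fun y hy v => ?_⟩
    exact (Projectivization.submodule_eq (K := ℂ) (V := Fin (n + 1) → ℂ) y).ge
      (sub_eval_lineEquation_mem hy v)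

theorem LineIn.exists_rep_plucker_eq {n : ℕ} (W : LineIn n) :
    ∃ u v : Fin (n + 1) → ℂ, W.1 = Submodule.span ℂ {u, v} ∧ W.plucker.rep = pluckerCoord u v := by
  obtain ⟨a, ha⟩ := Projectivization.exists_smul_eq_mk_rep ℂ
    (pluckerCoord (W.basis 0 : Fin (n + 1) → ℂ) (W.basis 1)) W.plucker_ne_zero
  -- The chosen representative is `a` times the Plücker vector of the basis; the unit `a` is
  -- absorbed into the first basis vector.
  refine ⟨(a : ℂ) • (W.basis 0 : Fin (n + 1) → ℂ), W.basis 1, W.span_basis.symm.trans ?_, ?_⟩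
  · rw [Submodule.span_insert, Submodule.span_insert, Submodule.span_singleton_smul_eq a.isUnit]
  · refine ha.symm.trans (funext fun p => ?_)
    simp [pluckerCoord, Units.smul_def]
    ring

theorem isLinearEquations_grassmannianOfLines (n : ℕ) :
    AlgBundle.IsLinearEquations (X := grassmannianOfLines n)
      (fun W : (grassmannianOfLines n).Pt => Subtype.val W) (planeEquation (Fin (n + 1))) where
  homogeneous := isHomogeneous_planeEquation
  vanish := by
    rintro ⟨i, j, k⟩ W w hw
    obtain ⟨u, v, hW, hr⟩ := LineIn.exists_rep_plucker_eq W
    rw [hW] at hw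
    have h := eval_planeEquation_of_mem i j k hw
    rw [← hr] at h
    exact h
  chart := by
    rintro ⟨j, k⟩
    refine ⟨fun i => (i, j, k), fun W hy w => ?_⟩
    obtain ⟨u, v, hW, hr⟩ := LineIn.exists_rep_plucker_eq W
    rw [hW]
    have h : pluckerCoord u v (j, k) ≠ 0 := by
      rw [← hr]
      exact hy
    have h' := sub_eval_planeEquation_mem h w
    rw [← hr] at h'
    exact h'

instance (n : ℕ) : Fintype (projectiveSpace n).Coord :=
  inferInstanceAs (Fintype (Fin (n + 1)))

instance (n : ℕ) : Fintype (grassmannianOfLines n).Coord :=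
  inferInstanceAs (Fintype (Fin (n + 1) × Fin (n + 1)))

end

theorem proposition2p2 (n d : ℕ) (hd : 0 < d) :
    ((kernelBundleProj n d).tensor (projectiveSpace n).twistOne).GloballyGenerated ∧
    ((kernelBundleGrass n d).tensor (grassmannianOfLines n).twistOne).GloballyGenerated :=
  ⟨AlgBundle.globallyGenerated_ker_evaluation (isLinearEquations_projectiveSpace n),
    AlgBundle.globallyGenerated_ker_evaluation (isLinearEquations_grassmannianOfLines n)⟩
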